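/- Let $d\ge 2$, $\boldsymbol\alpha\in\mathbb{R}^d_{>0}$ and $\alpha_m:=\min_i\alpha_i$. A dataset is a tuple of $N$ entries; two datasets are neighboring if they differ on a single entry. Let $D\mapsto\mathbf{x}(D)\in\mathbb{R}^d_{\ge 0}$ be a statistic of datasets and let $\Delta_2,\Delta_\infty>0$ be constants such that for all neighboring datasets $D,D'$, with $\mathbf{x}=\mathbf{x}(D)$ and $\mathbf{x}'=\mathbf{x}(D')$, $$\sum_i (x_i-x_i')^2\le\Delta_2^2\qquad\text{and}\qquad \max_i|x_i-x_i'|\le\Delta_\infty .$$ For $\lambda\in(1,\alpha_m/\Delta_\infty+1)$ define $$g(\lambda):=(\lambda-1)\Delta_\infty,\qquad \hat\varepsilon(\lambda):=\tfrac12\lambda\Delta_2^2\,\psi'(\alpha_m-g(\lambda)),$$ where $\psi'=(\log\Gamma)''$ is the trigamma function. Then for every $\varepsilon>0$ the function $$h(\lambda):=\frac{\exp\big((\lambda-1)(\hat\varepsilon(\lambda)-\varepsilon)\big)}{\lambda-1}\Big(1-\frac1\lambda\Big)^{\lambda}$$ attains a minimum $\delta$ on $(1,\alpha_m/\Delta_\infty+1)$,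 and the mechanism that on input $D$ releases a single draw from the Dirichlet distribution $\operatorname{Dir}(\mathbf{x}(D)+\boldsymbol\alpha)$, with density $\mathbf{y}\mapsto B(\mathbf{x}(D)+\boldsymbol\alpha)^{-1}\prod_i y_i^{x_i(D)+\alpha_i-1}$ (where $B(\mathbf{u})=\prod_i\Gamma(u_i)/\Gamma(\sum_i u_i)$) on the open probability simplex with respect to Lebesgue measure in $d-1$ of the coordinates, is $(\varepsilon,\delta)$-differentially private: for all neighboring $D,D'$ and all measurable $E\subseteq\mathbb{R}^d$, if $\mathbf{Y}\sim\operatorname{Dir}(\mathbf{x}(D)+\boldsymbol\alpha)$ and $\mathbf{Y}'\sim\operatorname{Dir}(\mathbf{x}(D')+\boldsymbol\alpha)$, then $\mathbb{P}[\mathbf{Y}\in E]\le e^{\varepsilon}\,\mathbb{P}[\mathbf{Y}'\in E]+\delta$. -/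

import Mathlib

open MeasureTheory

noncomputable section

namespace DirichletPrivacy

/-- Two datasets, given by `N` entries, the `i`-th of which takes values in `X i`, are neighboring
if they differ on a single entry. (An entry may be a whole row of a table, or one attribute of a
row, whence the dependence of `X i` on `i`.) -/
def Neighboring {N : ℕ} {X : Fin N → Type*} (D D' : ∀ i, X i) : Prop :=
  ∃ i, D i ≠ D' i ∧ ∀ j, j ≠ i → D j = D' j

/-- A randomized mechanism, given by the law `M D` of its output on each dataset `D`, is
`(ε, δ)`-differentially private: every `M D` is a probability distribution, and
`P[M D ∈ S] ≤ exp ε * P[M D' ∈ S] + δ` for all neighboring `D`, `D'` and all events `S`. -/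
structure IsDifferentiallyPrivate {N : ℕ} {X : Fin N → Type*} {Y : Type*} [MeasurableSpace Y]
    (M : (∀ i, X i) → Measure Y) (ε δ : ℝ) : Prop where
  isProbabilityMeasure : ∀ D, IsProbabilityMeasure (M D)
  measureReal_le : ∀ D D', Neighboring D D' → ∀ S : Set Y, MeasurableSet S →
    (M D).real S ≤ Real.exp ε * (M D').real S + δ

/-- The open probability simplex in `ℝ^(n+1)`. -/
def openSimplex (n : ℕ) : Set (Fin (n + 1) → ℝ) :=
  {y | (∀ i, 0 < y i) ∧ ∑ i, y i = 1}

/-- The parametrization `(z₁, …, zₙ) ↦ (z₁, …, zₙ, 1 - ∑ zᵢ)` of the hyperplane `∑ yᵢ = 1`. -/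
def simplexChart (n : ℕ) (z : Fin n → ℝ) : Fin (n + 1) → ℝ :=
  Fin.snoc (α := fun _ => ℝ) z (1 - ∑ j, z j)

theorem measurable_simplexChart (n : ℕ) : Measurable (simplexChart n) := by
  refine measurable_pi_lambda _ fun i => ?_
  refine Fin.lastCases ?_ (fun j => ?_) i
  · simp only [simplexChart, Fin.snoc_last]
    fun_prop
  · simp only [simplexChart, Fin.snoc_castSucc]
    fun_prop

/-- The reference measure for Dirichlet densities: Lebesgue measure in the first `n` coordinates,
carried to the open simplex in `ℝ^(n+1)`. -/
def simplexVolume (n : ℕ) : Measure (Fin (n + 1) → ℝ) :=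
  ((volume : Measure (Fin n → ℝ)).map (simplexChart n)).restrict (openSimplex n)

/-- The multivariate beta function `(∏ Γ(αᵢ)) / Γ(∑ αᵢ)`. -/
def multiBeta {n : ℕ} (α : Fin (n + 1) → ℝ) : ℝ :=
  (∏ i, Real.Gamma (α i)) / Real.Gamma (∑ i, α i)

/-- The Dirichlet density on the open simplex. -/
def dirichletPDF {n : ℕ} (α : Fin (n + 1) → ℝ) (y : Fin (n + 1) → ℝ) : ℝ :=
  1 / multiBeta α * ∏ i, y i ^ (α i - 1)

/-- The Dirichlet distribution `Dir(α)`, as a measure on `ℝ^(n+1)` carried by the open simplex. -/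
def dirichlet {n : ℕ} (α : Fin (n + 1) → ℝ) : Measure (Fin (n + 1) → ℝ) :=
  (simplexVolume n).withDensity fun y => ENNReal.ofReal (dirichletPDF α y)

/-- The digamma function `ψ`, the derivative of `log Γ`. -/
def digamma (x : ℝ) : ℝ := deriv (fun t => Real.log (Real.Gamma t)) x

/-- The trigamma function `ψ'`, the derivative of `ψ`. -/
def trigamma (x : ℝ) : ℝ := deriv digamma x

/-- `½ λ Δ₂² ψ'(a - (λ - 1) Δ∞)`, with `l` for `λ`, `D2` for `Δ₂` and `Dinf` for `Δ∞`. -/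
def renyiBound (a D2 Dinf l : ℝ) : ℝ :=
  1 / 2 * l * D2 ^ 2 * trigamma (a - (l - 1) * Dinf)

/-- `exp((λ - 1)(ε̂(λ) - ε)) / (λ - 1) * (1 - 1/λ)^λ`, where `ε̂(λ) = renyiBound a D2 Dinf λ`. -/
def deltaBound (a D2 Dinf ε l : ℝ) : ℝ :=
  Real.exp ((l - 1) * (renyiBound a D2 Dinf l - ε)) / (l - 1) * (1 - 1 / l) ^ l

end DirichletPrivacy

end

/-!
Privacy of a single draw from a Dirichlet distribution, through its Rényi divergence of order `l`.

For likelihood ratios `t = p / q`, the inequality `t ≤ exp ε + c * t ^ l` with the best constant `c`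
(`le_exp_mul_add_rpow`) bounds `P(S) - exp ε * Q(S)` by `c` times the moment `∫ p ^ l * q ^ (1 - l)`.
For the Dirichlet densities with parameters `u` and `v`, the integrand of this moment is a multiple
of the Dirichlet density with parameters `w = u + (l - 1) * (u - v)`, so the moment is
`B(w) * B(v) ^ (l - 1) / B(u) ^ l` (`dirichlet_le_exp_mul_add`). Its logarithm is a second-order
difference of `log B = ∑ log Γ - log Γ(∑)` along the segment from `v` through `u` to `w`. The term
`log Γ(∑)` contributes with a favourable sign because `log Γ` is convex, and each remaining term is
controlled by a bound for the curvature of `log Γ` on the segment, namely the value of the trigamma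
function at a lower bound for the parameters (`log_multiBeta_extrapolation_le`).

Two facts about special functions are needed. That `trigamma` is decreasing is read off from
`trigamma x = ∑ 1 / (x + m) ^ 2` (`trigamma_eq_tsum`), which follows from
`digamma (x + 1) = digamma x + 1 / x` and the monotonicity of `digamma`. The normalization of the
Dirichlet density is an iterated Beta integral, expressed as a convolution of powers
(`lintegral_prod_powerKernel`).

The minimum over `l` is attained because the logarithm of `deltaBound`, extended by `0` to the
left endpoint `l = 1`, is continuous, takes negative values near `1`, and tends to infinity at the right endpoint
(`exists_isMinOn_deltaBound`).
-/

open MeasureTheory Filter Topology Set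

namespace DirichletPrivacy

/-! ### The digamma and trigamma functions on the positive half-line -/

theorem differentiableAt_log_Gamma {x : ℝ} (hx : 0 < x) :
    DifferentiableAt ℝ (fun t => Real.log (Real.Gamma t)) x := by
  refine (Real.differentiableAt_Gamma fun m => ?_).log (Real.Gamma_pos_of_pos hx).ne'
  have : (0 : ℝ) ≤ m := m.cast_nonneg
  linarith

theorem digamma_monotoneOn : MonotoneOn digamma (Ioi 0) :=
  Real.convexOn_log_Gamma.monotoneOn_deriv fun _ hx => differentiableAt_log_Gamma hx

theorem digamma_add_one {x : ℝ} (hx : 0 < x) : digamma (x + 1) = digamma x + 1 / x := by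
  have h : (fun t => Real.log (Real.Gamma (t + 1))) =ᶠ[𝓝 x]
      fun t => Real.log (Real.Gamma t) + Real.log t := by
    filter_upwards [lt_mem_nhds hx] with t ht
    rw [Real.Gamma_add_one ht.ne', Real.log_mul ht.ne' (Real.Gamma_pos_of_pos ht).ne', add_comm]
  have h2 := h.deriv_eq
  rw [deriv_comp_add_const (f := fun t => Real.log (Real.Gamma t)),
    deriv_fun_add (differentiableAt_log_Gamma hx) (Real.differentiableAt_log hx.ne'),
    Real.deriv_log] at h2
  rw [digamma, digamma, h2, one_div]

theorem digamma_add_nat {x : ℝ} (hx : 0 < x) (n : ℕ) :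
    digamma (x + n) = digamma x + ∑ m ∈ Finset.range n, 1 / (x + m) := by
  induction n with
  | zero => simp
  | succ n ih =>
    have hxn : 0 < x + n := by positivity
    rw [Finset.sum_range_succ, Nat.cast_succ, ← add_assoc, digamma_add_one hxn, ih, add_assoc]

/-- Since `digamma` is monotone, it grows on an interval of bounded length starting at `n` by at
most a bounded number of terms `1 / (n + m)`. -/
theorem tendsto_digamma_add_nat_sub {x y : ℝ} (hx : 0 < x) (hy : 0 < y) :
    Tendsto (fun n : ℕ => digamma (y + n) - digamma (x + n)) atTop (𝓝 0) := by
  obtain ⟨k, hk⟩ := exists_nat_ge (max x y)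
  have hkx := (le_max_left _ _).trans hk
  have hky := (le_max_right _ _).trans hk
  have hlim : Tendsto (fun n : ℕ => ∑ m ∈ Finset.range k, 1 / ((n : ℝ) + m)) atTop (𝓝 0) := by
    rw [← Finset.sum_const_zero (s := Finset.range k)]
    refine tendsto_finsetSum _ fun m _ => ?_
    simp only [one_div]
    exact tendsto_inv_atTop_zero.comp
      (tendsto_atTop_add_const_right _ _ tendsto_natCast_atTop_atTop)
  rw [tendsto_zero_iff_abs_tendsto_zero]
  refine tendsto_of_tendsto_of_tendsto_of_le_of_le' tendsto_const_nhds hlim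
    (Eventually.of_forall fun _ => abs_nonneg _) ?_
  filter_upwards [eventually_gt_atTop 0] with n hn
  have hn' : (0 : ℝ) < n := by exact_mod_cast hn
  have hmono : ∀ z : ℝ, 0 < z → z ≤ k →
      digamma n ≤ digamma (z + n) ∧ digamma (z + n) ≤ digamma (n + k) := fun z hz hzk =>
    ⟨digamma_monotoneOn (mem_Ioi.2 hn') (mem_Ioi.2 (by linarith)) (by linarith),
      digamma_monotoneOn (mem_Ioi.2 (by linarith)) (mem_Ioi.2 (by positivity)) (by linarith)⟩
  have h1 := hmono x hx hkx
  have h2 := hmono y hy hky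
  have h3 := digamma_add_nat hn' k
  rw [Function.comp_apply, abs_le]
  constructor <;> linarith

theorem hasSum_digamma_sub_one {x : ℝ} (hx : 0 < x)
    (hs : Summable fun m : ℕ => 1 / (1 + m : ℝ) - 1 / (x + m)) :
    HasSum (fun m : ℕ => 1 / (1 + m : ℝ) - 1 / (x + m)) (digamma x - digamma 1) := by
  rw [hs.hasSum_iff_tendsto_nat]
  have h := (tendsto_digamma_add_nat_sub zero_lt_one hx).const_sub (digamma x - digamma 1)
  rw [sub_zero] at h
  refine h.congr fun n => ?_
  rw [Finset.sum_sub_distrib, digamma_add_nat hx, digamma_add_nat zero_lt_one]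
  ring

theorem summable_one_div_add_sq (x : ℝ) : Summable fun m : ℕ => 1 / (x + m) ^ 2 := by
  have h := (Real.summable_one_div_nat_add_rpow x 2).2 one_lt_two
  refine h.congr fun m => ?_
  norm_cast
  rw [sq_abs, add_comm]

theorem hasDerivAt_digamma {x : ℝ} (hx : 0 < x) :
    HasDerivAt digamma (∑' m : ℕ, 1 / (x + m) ^ 2) x := by
  -- The series of the derivatives is dominated on the half-line starting at `r`.
  obtain ⟨r, hr, hrx⟩ : ∃ r, 0 < r ∧ r < min x 1 := exists_between (lt_min hx one_pos)
  obtain ⟨hrx, hr1⟩ := lt_min_iff.1 hrx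
  have hpos : ∀ (m : ℕ) (y : ℝ), y ∈ Ioi r → 0 < y + m := fun m y hy =>
    add_pos_of_pos_of_nonneg (hr.trans hy) m.cast_nonneg
  have hg : ∀ (m : ℕ) (y : ℝ), y ∈ Ioi r →
      HasDerivAt (fun y : ℝ => 1 / (1 + m : ℝ) - 1 / (y + m)) (1 / (y + m) ^ 2) y := by
    intro m y hy
    have h := (((hasDerivAt_id y).add_const (m : ℝ)).fun_inv (hpos m y hy).ne').const_sub
      (1 / (1 + m : ℝ))
    simpa [one_div, neg_div] using h
  have hg' : ∀ (m : ℕ) (y : ℝ), y ∈ Ioi r → ‖1 / (y + m) ^ 2‖ ≤ 1 / (r + m) ^ 2 := by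
    intro m y hy
    have hy' := hpos m y hy
    have : 0 < r + m := by positivity
    rw [Real.norm_of_nonneg (by positivity)]
    gcongr
    exact le_of_lt hy
  have hsum := fun y hy => summable_of_summable_hasDerivAt_of_isPreconnected
    (summable_one_div_add_sq r) isOpen_Ioi isPreconnected_Ioi hg hg' (mem_Ioi.2 hr1)
    (by simp) (y := y) hy
  have h := (hasDerivAt_tsum_of_isPreconnected (summable_one_div_add_sq r) isOpen_Ioi
    isPreconnected_Ioi hg hg' (mem_Ioi.2 hrx) (hsum x hrx) (mem_Ioi.2 hrx)).const_add (digamma 1)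
  refine h.congr_of_eventuallyEq ?_
  filter_upwards [lt_mem_nhds hrx] with y hy
  rw [(hasSum_digamma_sub_one (hr.trans hy) (hsum y hy)).tsum_eq]
  ring

theorem trigamma_eq_tsum {x : ℝ} (hx : 0 < x) : trigamma x = ∑' m : ℕ, 1 / (x + m) ^ 2 :=
  (hasDerivAt_digamma hx).deriv

theorem trigamma_antitoneOn : AntitoneOn trigamma (Ioi 0) := by
  intro x hx y hy hxy
  rw [trigamma_eq_tsum hx, trigamma_eq_tsum hy]
  refine (summable_one_div_add_sq y).tsum_le_tsum (fun m => ?_) (summable_one_div_add_sq x)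
  have : 0 < x + m := add_pos_of_pos_of_nonneg hx m.cast_nonneg
  gcongr

theorem one_div_sq_le_trigamma {x : ℝ} (hx : 0 < x) : 1 / x ^ 2 ≤ trigamma x := by
  rw [trigamma_eq_tsum hx]
  simpa using (summable_one_div_add_sq x).le_tsum 0 fun m _ => by positivity

theorem trigamma_pos {x : ℝ} (hx : 0 < x) : 0 < trigamma x :=
  (one_div_pos.2 (pow_pos hx 2)).trans_le (one_div_sq_le_trigamma hx)

theorem continuousOn_trigamma : ContinuousOn trigamma (Ioi 0) := by
  intro x hx
  obtain ⟨r, hr, hrx⟩ := exists_between (mem_Ioi.1 hx)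
  have hpos : ∀ (m : ℕ) (y : ℝ), y ∈ Ioi r → 0 < y + m := fun m y hy =>
    add_pos_of_pos_of_nonneg (hr.trans hy) m.cast_nonneg
  have h : ContinuousOn (fun y : ℝ => ∑' m : ℕ, 1 / (y + m) ^ 2) (Ioi r) := by
    refine continuousOn_tsum (fun m => ?_) (summable_one_div_add_sq r) fun m y hy => ?_
    · exact continuousOn_const.div (by fun_prop) fun y hy => (pow_pos (hpos m y hy) 2).ne'
    · have hy' := hpos m y hy
      have : 0 < r + m := by positivity
      rw [Real.norm_of_nonneg (by positivity)]
      gcongr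
      exact le_of_lt hy
  refine ((h.congr fun y hy => trigamma_eq_tsum (hr.trans hy)).continuousAt
    (Ioi_mem_nhds hrx)).continuousWithinAt

/-- The second derivative of `log Γ` is at most `trigamma a` on `[a, ∞)`, so that subtracting
`log Γ` from a parabola of that curvature leaves a convex function. -/
theorem convexOn_sq_sub_log_Gamma {a : ℝ} (ha : 0 < a) :
    ConvexOn ℝ (Ici a) fun t => trigamma a / 2 * t ^ 2 - Real.log (Real.Gamma t) := by
  have hpos : ∀ t ∈ interior (Ici a), 0 < t ∧ a ≤ t := fun t ht => by
    rw [interior_Ici] at ht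
    exact ⟨ha.trans ht, le_of_lt ht⟩
  refine convexOn_of_hasDerivWithinAt2_nonneg (f' := fun t => trigamma a * t - digamma t)
    (f'' := fun t => trigamma a - trigamma t) (convex_Ici a) ?_ ?_ ?_ ?_
  · intro t ht
    exact (((continuousAt_id.pow 2).const_mul _).sub
      (differentiableAt_log_Gamma (ha.trans_le ht)).continuousAt).continuousWithinAt
  · intro t ht
    have h := ((hasDerivAt_pow 2 t).const_mul (trigamma a / 2)).sub
      (differentiableAt_log_Gamma (hpos t ht).1).hasDerivAt
    refine (h.congr_deriv ?_).hasDerivWithinAt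
    rw [digamma]
    push_cast
    ring
  · intro t ht
    have h := ((hasDerivAt_id t).const_mul (trigamma a)).sub (hasDerivAt_digamma (hpos t ht).1)
    rw [← trigamma_eq_tsum (hpos t ht).1, mul_one] at h
    exact h.hasDerivWithinAt
  · intro t ht
    exact sub_nonneg.2 (trigamma_antitoneOn ha (hpos t ht).1 (hpos t ht).2)

/-- Convexity at a point `u` of the segment between `v` and `u + (l - 1) * (u - v)`, where `u`
carries the weight `l = 1 + (l - 1)`. -/
theorem _root_.ConvexOn.extrapolation_nonneg {s : Set ℝ} {f : ℝ → ℝ} (hf : ConvexOn ℝ s f)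
    {l u v : ℝ} (hl : 1 < l) (hv : v ∈ s) (hw : u + (l - 1) * (u - v) ∈ s) :
    0 ≤ f (u + (l - 1) * (u - v)) - l * f u + (l - 1) * f v := by
  have hl0 : 0 < l := by linarith
  have h3 : ∀ x y : ℝ, l * ((1 / l) • x + ((l - 1) / l) • y) = x + (l - 1) * y := fun x y => by
    simp only [smul_eq_mul]
    field_simp
  have hu : (1 / l) • (u + (l - 1) * (u - v)) + ((l - 1) / l) • v = u :=
    mul_left_cancel₀ hl0.ne' (by rw [h3]; ring)
  have h1 : 0 ≤ 1 / l := by positivity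
  have h2 : 0 ≤ (l - 1) / l := div_nonneg (by linarith) hl0.le
  have h := hf.2 hw hv h1 h2 (by field_simp; ring)
  rw [hu] at h
  have h4 := mul_le_mul_of_nonneg_left h hl0.le
  rw [h3] at h4
  linarith

theorem log_Gamma_extrapolation_le {a l u v : ℝ} (ha : 0 < a) (hl : 1 < l) (hv : a ≤ v)
    (hw : a ≤ u + (l - 1) * (u - v)) :
    Real.log (Real.Gamma (u + (l - 1) * (u - v))) - l * Real.log (Real.Gamma u)
      + (l - 1) * Real.log (Real.Gamma v) ≤ 1 / 2 * l * (l - 1) * trigamma a * (u - v) ^ 2 := by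
  have h := (convexOn_sq_sub_log_Gamma ha).extrapolation_nonneg hl hv hw
  linear_combination h

/-! ### The Dirichlet integral -/

/-- The power function `t ↦ t ^ (a - 1)` on the positive half-line, extended by `0`. Divided by
`Γ(a)`, these functions form the Riemann-Liouville convolution semigroup. -/
noncomputable def powerKernel (a t : ℝ) : ENNReal :=
  (Ioi (0 : ℝ)).indicator (fun t => ENNReal.ofReal (t ^ (a - 1))) t

@[fun_prop]
theorem measurable_powerKernel (a : ℝ) : Measurable (powerKernel a) :=
  Measurable.indicator (by fun_prop) measurableSet_Ioi

theorem powerKernel_of_pos (a : ℝ) {t : ℝ} (ht : 0 < t) :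
    powerKernel a t = ENNReal.ofReal (t ^ (a - 1)) := indicator_of_mem (mem_Ioi.2 ht) _

theorem powerKernel_of_nonpos (a : ℝ) {t : ℝ} (ht : t ≤ 0) : powerKernel a t = 0 :=
  indicator_of_notMem (notMem_Ioi.2 ht) _

theorem powerKernel_mul (a : ℝ) {s : ℝ} (hs : 0 < s) (t : ℝ) :
    powerKernel a (s * t) = ENNReal.ofReal (s ^ (a - 1)) * powerKernel a t := by
  rcases le_or_gt t 0 with ht | ht
  · rw [powerKernel_of_nonpos a ht,
      powerKernel_of_nonpos a (mul_nonpos_of_nonneg_of_nonpos hs.le ht), mul_zero]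
  · rw [powerKernel_of_pos a ht, powerKernel_of_pos a (mul_pos hs ht),
      Real.mul_rpow hs.le ht.le, ENNReal.ofReal_mul (by positivity)]

theorem lintegral_powerKernel_mul_one_sub {a b : ℝ} (ha : 0 < a) (hb : 0 < b) :
    ∫⁻ t, powerKernel a t * powerKernel b (1 - t) = ENNReal.ofReal (ProbabilityTheory.beta a b) := by
  have hB := ProbabilityTheory.beta_pos ha hb
  have h : ∀ t, powerKernel a t * powerKernel b (1 - t) =
      ENNReal.ofReal (ProbabilityTheory.beta a b) * ProbabilityTheory.betaPDF a b t := by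
    intro t
    rcases le_or_gt t 0 with ht | ht
    · rw [powerKernel_of_nonpos a ht, ProbabilityTheory.betaPDF_eq_zero_of_nonpos ht, zero_mul,
        mul_zero]
    rcases le_or_gt 1 t with ht1 | ht1
    · rw [powerKernel_of_nonpos b (sub_nonpos.2 ht1),
        ProbabilityTheory.betaPDF_eq_zero_of_one_le ht1, mul_zero, mul_zero]
    rw [powerKernel_of_pos a ht, powerKernel_of_pos b (sub_pos.2 ht1),
      ProbabilityTheory.betaPDF_of_pos_lt_one ht ht1, ← ENNReal.ofReal_mul (by positivity),
      ← ENNReal.ofReal_mul hB.le]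
    congr 1
    field_simp
  simp_rw [h]
  rw [lintegral_const_mul' _ _ ENNReal.ofReal_ne_top,
    ProbabilityTheory.lintegral_betaPDF_eq_one ha hb, mul_one]

theorem lintegral_powerKernel_mul_sub {a b : ℝ} (ha : 0 < a) (hb : 0 < b) (s : ℝ) :
    ∫⁻ t, powerKernel a t * powerKernel b (s - t) =
      ENNReal.ofReal (ProbabilityTheory.beta a b) * powerKernel (a + b) s := by
  rcases le_or_gt s 0 with hs | hs
  · rw [powerKernel_of_nonpos _ hs, mul_zero, lintegral_eq_zero_iff (by fun_prop)]
    refine Eventually.of_forall fun t => ?_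
    rcases le_or_gt t 0 with ht | ht
    · simp [powerKernel_of_nonpos _ ht]
    · simp [powerKernel_of_nonpos b (show s - t ≤ 0 by linarith)]
  · rw [← Real.smul_map_volume_mul_left hs.ne', lintegral_smul_measure,
      lintegral_map (by fun_prop) (by fun_prop)]
    have h : ∀ t, powerKernel a (s * t) * powerKernel b (s - s * t) =
        ENNReal.ofReal (s ^ (a - 1) * s ^ (b - 1)) *
          (powerKernel a t * powerKernel b (1 - t)) := by
      intro t
      rw [show s - s * t = s * (1 - t) by ring, powerKernel_mul a hs, powerKernel_mul b hs,
        ENNReal.ofReal_mul (by positivity)]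
      ring
    simp_rw [h]
    rw [lintegral_const_mul' _ _ ENNReal.ofReal_ne_top, lintegral_powerKernel_mul_one_sub ha hb,
      powerKernel_of_pos _ hs, smul_eq_mul, abs_of_pos hs, ← mul_assoc,
      ← ENNReal.ofReal_mul hs.le, mul_comm]
    congr 2
    rw [show a + b - 1 = 1 + ((a - 1) + (b - 1)) by ring, Real.rpow_add hs, Real.rpow_add hs,
      Real.rpow_one]

/-- The iterated convolution of `n + 1` power kernels is a power kernel. -/
theorem lintegral_prod_powerKernel {n : ℕ} {a : Fin n → ℝ} {b : ℝ} (ha : ∀ i, 0 < a i)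
    (hb : 0 < b) (s : ℝ) :
    ∫⁻ z : Fin n → ℝ, (∏ i, powerKernel (a i) (z i)) * powerKernel b (s - ∑ i, z i) =
      ENNReal.ofReal ((∏ i, Real.Gamma (a i)) * Real.Gamma b / Real.Gamma (∑ i, a i + b)) *
        powerKernel (∑ i, a i + b) s := by
  induction n generalizing s with
  | zero =>
    have := (Real.Gamma_pos_of_pos hb).ne'
    simp [this, volume_pi]
  | succ n ih =>
    have hsum : 0 < ∑ i : Fin n, a i.succ + b :=
      add_pos_of_nonneg_of_pos (Finset.sum_nonneg fun i _ => (ha _).le) hb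
    rw [← (volume_preserving_piFinSuccAbove (fun _ : Fin (n + 1) => ℝ) 0).symm.lintegral_comp_emb
      (MeasurableEquiv.measurableEmbedding _), Measure.volume_eq_prod,
      lintegral_prod _ (by fun_prop)]
    have h : ∀ (t : ℝ) (z : Fin n → ℝ),
        (∏ i, powerKernel (a i) ((MeasurableEquiv.piFinSuccAbove (fun _ : Fin (n + 1) => ℝ) 0).symm
          (t, z) i)) * powerKernel b (s - ∑ i,
            (MeasurableEquiv.piFinSuccAbove (fun _ : Fin (n + 1) => ℝ) 0).symm (t, z) i) =
        powerKernel (a 0) t * ((∏ i : Fin n, powerKernel (a i.succ) (z i)) *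
          powerKernel b (s - t - ∑ i, z i)) := by
      intro t z
      simp only [MeasurableEquiv.piFinSuccAbove_symm_apply, Fin.insertNthEquiv_zero,
        Fin.consEquiv_apply, Fin.prod_univ_succ, Fin.sum_univ_succ, Fin.cons_zero, Fin.cons_succ]
      rw [mul_assoc, sub_sub]
    simp_rw [h]
    have h2 : ∀ t, ∫⁻ z : Fin n → ℝ, powerKernel (a 0) t *
        ((∏ i : Fin n, powerKernel (a i.succ) (z i)) * powerKernel b (s - t - ∑ i, z i)) =
        ENNReal.ofReal ((∏ i : Fin n, Real.Gamma (a i.succ)) * Real.Gamma b /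
          Real.Gamma (∑ i : Fin n, a i.succ + b)) *
            (powerKernel (a 0) t * powerKernel (∑ i : Fin n, a i.succ + b) (s - t)) := by
      intro t
      rw [lintegral_const_mul _ (by fun_prop), ih (fun i => ha i.succ)]
      ring
    simp_rw [h2]
    have hG : ∀ x : ℝ, 0 < x → 0 < Real.Gamma x := fun x => Real.Gamma_pos_of_pos
    have hp : 0 < ∏ i : Fin n, Real.Gamma (a i.succ) := Finset.prod_pos fun i _ => hG _ (ha _)
    have hGb := hG _ hb
    have hGs := hG _ hsum
    rw [lintegral_const_mul' _ _ ENNReal.ofReal_ne_top, lintegral_powerKernel_mul_sub (ha 0) hsum,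
      ← mul_assoc, ← ENNReal.ofReal_mul (by positivity), Fin.sum_univ_succ, Fin.prod_univ_succ,
      add_assoc, ProbabilityTheory.beta]
    congr 2
    field_simp

theorem multiBeta_pos {n : ℕ} {w : Fin (n + 1) → ℝ} (hw : ∀ i, 0 < w i) : 0 < multiBeta w :=
  div_pos (Finset.prod_pos fun i _ => Real.Gamma_pos_of_pos (hw i))
    (Real.Gamma_pos_of_pos (Finset.sum_pos (fun i _ => hw i) Finset.univ_nonempty))

theorem measurableSet_openSimplex (n : ℕ) : MeasurableSet (openSimplex n) := by
  have h : openSimplex n = (⋂ i, {y | 0 < y i}) ∩ {y | ∑ i, y i = 1} := by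
    ext y
    simp [openSimplex]
  rw [h]
  exact (MeasurableSet.iInter fun i =>
    measurableSet_lt measurable_const (measurable_pi_apply i)).inter
      (measurableSet_eq_fun (by fun_prop) measurable_const)

/-- The Dirichlet integral. -/
theorem lintegral_prod_rpow_simplexVolume {n : ℕ} {w : Fin (n + 1) → ℝ} (hw : ∀ i, 0 < w i) :
    ∫⁻ y, ENNReal.ofReal (∏ i, y i ^ (w i - 1)) ∂simplexVolume n =
      ENNReal.ofReal (multiBeta w) := by
  have hmeas : MeasurableSet (simplexChart n ⁻¹' openSimplex n) :=
    measurable_simplexChart n (measurableSet_openSimplex n)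
  rw [simplexVolume, setLIntegral_map (measurableSet_openSimplex n) (by fun_prop)
    (measurable_simplexChart n), ← lintegral_indicator hmeas]
  have h := lintegral_prod_powerKernel (fun i : Fin n => hw i.castSucc) (hw (Fin.last n)) 1
  rw [powerKernel_of_pos _ one_pos, Real.one_rpow, ENNReal.ofReal_one, mul_one,
    ← Fin.prod_univ_castSucc (fun i => Real.Gamma (w i)), ← Fin.sum_univ_castSucc w] at h
  rw [multiBeta, ← h]
  refine lintegral_congr fun z => ?_
  have hcs : ∀ i : Fin n, simplexChart n z i.castSucc = z i := fun i => by simp [simplexChart]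
  have hlast : simplexChart n z (Fin.last n) = 1 - ∑ j, z j := by simp [simplexChart]
  by_cases hz : z ∈ simplexChart n ⁻¹' openSimplex n
  · have hpos : ∀ i, 0 < simplexChart n z i := hz.1
    rw [indicator_of_mem hz, ENNReal.ofReal_prod_of_nonneg
      (fun i _ => Real.rpow_nonneg (hpos i).le _), Fin.prod_univ_castSucc, hlast,
      ← powerKernel_of_pos _ (hlast ▸ hpos (Fin.last n))]
    congr 1
    refine Finset.prod_congr rfl fun i _ => ?_
    rw [hcs, powerKernel_of_pos _ (hcs i ▸ hpos i.castSucc)]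
  · rw [indicator_of_notMem hz, eq_comm]
    -- The coordinates of the chart always sum to `1`, so one of them has to be nonpositive.
    have hsum : ∑ i, simplexChart n z i = 1 := by
      rw [Fin.sum_univ_castSucc, hlast]
      simp [hcs]
    have hex : ∃ i, simplexChart n z i ≤ 0 := by
      by_contra! hall
      exact hz ⟨hall, hsum⟩
    obtain ⟨i, hi⟩ := hex
    induction i using Fin.lastCases with
    | last =>
      rw [hlast] at hi
      rw [powerKernel_of_nonpos _ hi, mul_zero]
    | cast i =>
      rw [hcs] at hi
      rw [Finset.prod_eq_zero (Finset.mem_univ i) (powerKernel_of_nonpos _ hi), zero_mul]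

theorem dirichlet_isProbabilityMeasure {n : ℕ} {w : Fin (n + 1) → ℝ} (hw : ∀ i, 0 < w i) :
    IsProbabilityMeasure (dirichlet w) := by
  have hB := multiBeta_pos hw
  refine ⟨?_⟩
  rw [dirichlet, withDensity_apply _ MeasurableSet.univ, Measure.restrict_univ]
  simp_rw [dirichletPDF, ENNReal.ofReal_mul (one_div_pos.2 hB).le]
  rw [lintegral_const_mul' _ _ ENNReal.ofReal_ne_top, lintegral_prod_rpow_simplexVolume hw,
    ← ENNReal.ofReal_mul (by positivity), one_div_mul_cancel hB.ne', ENNReal.ofReal_one]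

/-! ### The Rényi bound for Dirichlet distributions -/

/-- The pointwise estimate behind the conversion of a Rényi bound of order `l` into approximate
differential privacy. The constant is the maximum of `(t - exp ε) / t ^ l` over the likelihood
ratios `t = p / q`. -/
theorem le_exp_mul_add_rpow {l p q : ℝ} (hl : 1 < l) (hp : 0 < p) (hq : 0 < q) (ε : ℝ) :
    p ≤ Real.exp ε * q +
      Real.exp (-((l - 1) * ε)) / (l - 1) * (1 - 1 / l) ^ l * (p ^ l * q ^ (1 - l)) := by
  have hl0 : 0 < l := by linarith
  have hl1 : 0 < l - 1 := by linarith
  have hr : 0 < 1 - 1 / l := by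
    rw [sub_pos, div_lt_one hl0]
    exact hl
  -- `s` is the likelihood ratio relative to its maximizing value `exp ε / (1 - 1 / l)`.
  set s := (1 - 1 / l) * p * Real.exp (-ε) / q with hs
  have hs0 : 0 < s := by positivity
  have hB := one_add_mul_self_le_rpow_one_add (s := s - 1) (by linarith) hl.le
  rw [add_sub_cancel] at hB
  have hsl : s ^ l = (1 - 1 / l) ^ l * p ^ l * Real.exp (-(l * ε)) * (q ^ l)⁻¹ := by
    rw [hs, Real.div_rpow (by positivity) hq.le, Real.mul_rpow (by positivity) (by positivity),
      Real.mul_rpow hr.le hp.le, ← Real.exp_mul, div_eq_mul_inv]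
    ring_nf
  have hE : Real.exp (-((l - 1) * ε)) = Real.exp ε * Real.exp (-(l * ε)) := by
    rw [← Real.exp_add]
    ring_nf
  have hE2 : Real.exp ε * Real.exp (-ε) = 1 := by rw [← Real.exp_add, add_neg_cancel, Real.exp_zero]
  have hq1 : q ^ (1 - l) = q * (q ^ l)⁻¹ := by
    rw [Real.rpow_sub hq, Real.rpow_one, div_eq_mul_inv]
  have h1 : Real.exp (-((l - 1) * ε)) / (l - 1) * (1 - 1 / l) ^ l * (p ^ l * q ^ (1 - l)) =
      Real.exp ε * q / (l - 1) * s ^ l := by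
    rw [hsl, hE, hq1]
    ring
  have h2 : p = Real.exp ε * q + Real.exp ε * q / (l - 1) * (1 + l * (s - 1)) := by
    have hps : Real.exp ε * q * s = (1 - 1 / l) * p := by
      rw [hs]
      field_simp
      linear_combination hE2
    have : p = l / (l - 1) * (Real.exp ε * q * s) := by
      rw [hps]
      field_simp
    rw [this]
    field_simp
    ring
  rw [h1]
  calc p = _ := h2
    _ ≤ _ := by gcongr

theorem dirichletPDF_pos {n : ℕ} {w y : Fin (n + 1) → ℝ} (hw : ∀ i, 0 < w i) (hy : ∀ i, 0 < y i) :
    0 < dirichletPDF w y :=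
  mul_pos (one_div_pos.2 (multiBeta_pos hw))
    (Finset.prod_pos fun i _ => Real.rpow_pos_of_pos (hy i) _)

/-- The integrand of the Rényi moment of order `l` of two Dirichlet densities is again a Dirichlet
density up to a constant, with parameters extrapolated from `v` through `u`. -/
theorem dirichletPDF_rpow_mul_rpow {n : ℕ} {u v y : Fin (n + 1) → ℝ} (hu : ∀ i, 0 < u i)
    (hv : ∀ i, 0 < v i) (hy : ∀ i, 0 < y i) (l : ℝ) :
    dirichletPDF u y ^ l * dirichletPDF v y ^ (1 - l) =
      Real.exp ((l - 1) * Real.log (multiBeta v) - l * Real.log (multiBeta u)) *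
        ∏ i, y i ^ (u i + (l - 1) * (u i - v i) - 1) := by
  have hBu := multiBeta_pos hu
  have hBv := multiBeta_pos hv
  have hprod : ∀ w : Fin (n + 1) → ℝ, 0 ≤ ∏ i, y i ^ (w i - 1) := fun w =>
    Finset.prod_nonneg fun i _ => Real.rpow_nonneg (hy i).le _
  rw [dirichletPDF, dirichletPDF, Real.mul_rpow (by positivity) (hprod u),
    Real.mul_rpow (by positivity) (hprod v), mul_mul_mul_comm,
    ← Real.finsetProd_rpow _ _ fun i _ => Real.rpow_nonneg (hy i).le _,
    ← Real.finsetProd_rpow _ _ fun i _ => Real.rpow_nonneg (hy i).le _, ← Finset.prod_mul_distrib]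
  congr 1
  · rw [Real.rpow_def_of_pos (by positivity), Real.rpow_def_of_pos (by positivity),
      ← Real.exp_add, one_div, one_div, Real.log_inv, Real.log_inv]
    congr 1
    ring
  · refine Finset.prod_congr rfl fun i _ => ?_
    rw [← Real.rpow_mul (hy i).le, ← Real.rpow_mul (hy i).le, ← Real.rpow_add (hy i)]
    congr 1
    ring

theorem dirichlet_le_exp_mul_add {n : ℕ} {u v : Fin (n + 1) → ℝ} {l : ℝ} (hl : 1 < l)
    (hu : ∀ i, 0 < u i) (hv : ∀ i, 0 < v i) (hw : ∀ i, 0 < u i + (l - 1) * (u i - v i)) (ε : ℝ)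
    {S : Set (Fin (n + 1) → ℝ)} (hS : MeasurableSet S) :
    dirichlet u S ≤ ENNReal.ofReal (Real.exp ε) * dirichlet v S +
      ENNReal.ofReal (Real.exp (-((l - 1) * ε)) / (l - 1) * (1 - 1 / l) ^ l *
        Real.exp ((l - 1) * Real.log (multiBeta v) - l * Real.log (multiBeta u)) *
          multiBeta fun i => u i + (l - 1) * (u i - v i)) := by
  have hl1 : 0 < l - 1 := by linarith
  have hr : 0 < 1 - 1 / l := by
    rw [sub_pos, div_lt_one (by linarith)]
    exact hl
  set c := Real.exp (-((l - 1) * ε)) / (l - 1) * (1 - 1 / l) ^ l *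
    Real.exp ((l - 1) * Real.log (multiBeta v) - l * Real.log (multiBeta u)) with hc
  have hc0 : 0 ≤ c := by positivity
  have hmem : ∀ᵐ y ∂(simplexVolume n).restrict S, y ∈ openSimplex n :=
    ae_restrict_of_ae (ae_restrict_mem (measurableSet_openSimplex n))
  have hmeas : ∀ w : Fin (n + 1) → ℝ, Measurable fun y => ENNReal.ofReal (dirichletPDF w y) := by
    intro w
    unfold dirichletPDF
    fun_prop
  rw [dirichlet, dirichlet, withDensity_apply _ hS, withDensity_apply _ hS,
    ENNReal.ofReal_mul hc0, ← lintegral_prod_rpow_simplexVolume hw,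
    ← lintegral_const_mul' _ _ ENNReal.ofReal_ne_top,
    ← lintegral_const_mul' _ _ ENNReal.ofReal_ne_top]
  refine le_trans ?_ (add_le_add_right (setLIntegral_le_lintegral S _) _)
  rw [← lintegral_add_left ((hmeas v).const_mul _)]
  refine lintegral_mono_ae ?_
  filter_upwards [hmem] with y hy
  have hq := dirichletPDF_pos hv hy.1
  have hprod : 0 ≤ ∏ i, y i ^ (u i + (l - 1) * (u i - v i) - 1) :=
    Finset.prod_nonneg fun i _ => Real.rpow_nonneg (hy.1 i).le _
  rw [← ENNReal.ofReal_mul (Real.exp_pos ε).le, ← ENNReal.ofReal_mul hc0,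
    ← ENNReal.ofReal_add (by positivity) (by positivity)]
  refine ENNReal.ofReal_le_ofReal ((le_exp_mul_add_rpow hl (dirichletPDF_pos hu hy.1) hq ε).trans_eq
    ?_)
  rw [dirichletPDF_rpow_mul_rpow hu hv hy.1, hc]
  ring

theorem log_multiBeta {n : ℕ} {w : Fin (n + 1) → ℝ} (hw : ∀ i, 0 < w i) :
    Real.log (multiBeta w) =
      ∑ i, Real.log (Real.Gamma (w i)) - Real.log (Real.Gamma (∑ i, w i)) := by
  have hsum : 0 < ∑ i, w i := Finset.sum_pos (fun i _ => hw i) Finset.univ_nonempty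
  rw [multiBeta, Real.log_div (Finset.prod_pos fun i _ => Real.Gamma_pos_of_pos (hw i)).ne'
    (Real.Gamma_pos_of_pos hsum).ne', Real.log_prod fun i _ => (Real.Gamma_pos_of_pos (hw i)).ne']

/-- The Rényi bound. The factor `1 / Γ(∑ wᵢ)` of the beta function only helps, by log-convexity
of `Γ`. -/
theorem log_multiBeta_extrapolation_le {n : ℕ} {u v : Fin (n + 1) → ℝ} {a l D2 : ℝ} (ha : 0 < a)
    (hl : 1 < l) (hu : ∀ i, 0 < u i) (hv : ∀ i, a ≤ v i)
    (hw : ∀ i, a ≤ u i + (l - 1) * (u i - v i)) (hD2 : ∑ i, (u i - v i) ^ 2 ≤ D2 ^ 2) :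
    Real.log (multiBeta fun i => u i + (l - 1) * (u i - v i)) - l * Real.log (multiBeta u) +
      (l - 1) * Real.log (multiBeta v) ≤ (l - 1) * (1 / 2 * l * D2 ^ 2 * trigamma a) := by
  have hv0 : ∀ i, 0 < v i := fun i => ha.trans_le (hv i)
  have hw0 : ∀ i, 0 < u i + (l - 1) * (u i - v i) := fun i => ha.trans_le (hw i)
  have hsum : ∑ i, (u i + (l - 1) * (u i - v i)) = ∑ i, u i + (l - 1) * (∑ i, u i - ∑ i, v i) := by
    rw [Finset.sum_add_distrib, ← Finset.mul_sum, Finset.sum_sub_distrib]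
  have hpos : ∀ w : Fin (n + 1) → ℝ, (∀ i, 0 < w i) → 0 < ∑ i, w i := fun w hw =>
    Finset.sum_pos (fun i _ => hw i) Finset.univ_nonempty
  have htotal := Real.convexOn_log_Gamma.extrapolation_nonneg hl (mem_Ioi.2 (hpos v hv0))
    (u := ∑ i, u i) (mem_Ioi.2 (hsum ▸ hpos _ hw0))
  have hterms := Finset.sum_le_sum fun i (_ : i ∈ Finset.univ) =>
    log_Gamma_extrapolation_le ha hl (hv i) (hw i)
  rw [Finset.sum_add_distrib, Finset.sum_sub_distrib, ← Finset.mul_sum, ← Finset.mul_sum,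
    ← Finset.mul_sum] at hterms
  have hD : 1 / 2 * l * (l - 1) * trigamma a * ∑ i, (u i - v i) ^ 2 ≤
      1 / 2 * l * (l - 1) * trigamma a * D2 ^ 2 := by
    have := trigamma_pos ha
    have : 0 < l - 1 := by linarith
    gcongr
  rw [log_multiBeta hw0, log_multiBeta hu, log_multiBeta hv0, hsum]
  simp only [Function.comp_apply] at htotal
  linarith

theorem dirichlet_real_le {n : ℕ} {u v : Fin (n + 1) → ℝ} {a l D2 Dinf : ℝ} (hDinf : 0 < Dinf)
    (hl : 1 < l) (hla : (l - 1) * Dinf < a) (hu : ∀ i, a ≤ u i) (hv : ∀ i, a ≤ v i)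
    (hD2 : ∑ i, (u i - v i) ^ 2 ≤ D2 ^ 2) (hD : ∀ i, |u i - v i| ≤ Dinf) (ε : ℝ)
    {S : Set (Fin (n + 1) → ℝ)} (hS : MeasurableSet S) :
    (dirichlet u).real S ≤ Real.exp ε * (dirichlet v).real S + deltaBound a D2 Dinf ε l := by
  have hl1 : 0 < l - 1 := by linarith
  have hr : 0 < 1 - 1 / l := by
    rw [sub_pos, div_lt_one (by linarith)]
    exact hl
  have hg : 0 < (l - 1) * Dinf := mul_pos hl1 hDinf
  have hb : 0 < a - (l - 1) * Dinf := by linarith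
  have hu0 : ∀ i, 0 < u i := fun i => by linarith [hu i]
  have hv0 : ∀ i, 0 < v i := fun i => by linarith [hv i]
  have hw : ∀ i, a - (l - 1) * Dinf ≤ u i + (l - 1) * (u i - v i) := fun i => by
    have := mul_le_mul_of_nonneg_left (neg_le_of_abs_le (hD i)) hl1.le
    linarith [hu i]
  have hw0 : ∀ i, 0 < u i + (l - 1) * (u i - v i) := fun i => hb.trans_le (hw i)
  have := dirichlet_isProbabilityMeasure hu0
  have := dirichlet_isProbabilityMeasure hv0
  have hR := log_multiBeta_extrapolation_le hb hl hu0 (fun i => by linarith [hv i]) hw hD2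
  have hd0 : 0 ≤ deltaBound a D2 Dinf ε l := by
    unfold deltaBound
    positivity
  have hle : Real.exp (-((l - 1) * ε)) / (l - 1) * (1 - 1 / l) ^ l *
      Real.exp ((l - 1) * Real.log (multiBeta v) - l * Real.log (multiBeta u)) *
        multiBeta (fun i => u i + (l - 1) * (u i - v i)) ≤ deltaBound a D2 Dinf ε l := by
    rw [mul_assoc _ (Real.exp _) (multiBeta _)]
    rw [← Real.exp_log (multiBeta_pos hw0)]
    have hδ : deltaBound a D2 Dinf ε l = Real.exp (-((l - 1) * ε)) / (l - 1) * (1 - 1 / l) ^ l *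
        Real.exp ((l - 1) * renyiBound a D2 Dinf l) := by
      rw [deltaBound, show (l - 1) * (renyiBound a D2 Dinf l - ε) =
        -((l - 1) * ε) + (l - 1) * renyiBound a D2 Dinf l by ring, Real.exp_add]
      ring
    rw [← Real.exp_add, hδ]
    gcongr
    rw [renyiBound]
    linarith
  have h := (dirichlet_le_exp_mul_add hl hu0 hv0 hw0 ε hS).trans
    (add_le_add_right (ENNReal.ofReal_le_ofReal hle) _)
  rw [← ofReal_measureReal, ← ofReal_measureReal, ← ENNReal.ofReal_mul (Real.exp_pos ε).le,
    ← ENNReal.ofReal_add (by positivity) hd0] at h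
  exact (ENNReal.ofReal_le_ofReal_iff (by positivity)).1 h

/-! ### Minimizing the bound over the order -/

/-- The logarithm of `deltaBound` for `l > 1`, written so that it extends continuously to `l = 1`. -/
noncomputable def logDeltaBound (a D2 Dinf ε l : ℝ) : ℝ :=
  (l - 1) * (renyiBound a D2 Dinf l - ε) + (l - 1) * Real.log (l - 1) - l * Real.log l

theorem deltaBound_eq_exp {l : ℝ} (hl : 1 < l) (a D2 Dinf ε : ℝ) :
    deltaBound a D2 Dinf ε l = Real.exp (logDeltaBound a D2 Dinf ε l) := by
  have hl0 : 0 < l := by linarith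
  have hl1 : 0 < l - 1 := by linarith
  have hr : 1 - 1 / l = (l - 1) / l := by field_simp
  have hr0 : 0 < (l - 1) / l := by positivity
  rw [deltaBound, hr, Real.rpow_def_of_pos hr0, Real.log_div hl1.ne' hl0.ne', div_eq_mul_inv,
    ← Real.exp_log (inv_pos.2 hl1), Real.log_inv, ← Real.exp_add, ← Real.exp_add, logDeltaBound]
  congr 1
  ring

theorem continuousOn_renyiBound {a Dinf : ℝ} (hDinf : 0 < Dinf) (D2 : ℝ) :
    ContinuousOn (renyiBound a D2 Dinf) (Iio (a / Dinf + 1)) := by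
  unfold renyiBound
  refine ContinuousOn.mul (by fun_prop) (continuousOn_trigamma.comp (by fun_prop) fun l hl => ?_)
  have : l - 1 < a / Dinf := by linarith [mem_Iio.1 hl]
  rw [mem_Ioi, sub_pos]
  exact (lt_div_iff₀ hDinf).1 this

theorem continuousOn_logDeltaBound {a Dinf : ℝ} (hDinf : 0 < Dinf) (D2 ε : ℝ) :
    ContinuousOn (logDeltaBound a D2 Dinf ε) (Iio (a / Dinf + 1)) := by
  unfold logDeltaBound
  exact ((ContinuousOn.mul (by fun_prop)
    ((continuousOn_renyiBound hDinf D2).sub continuousOn_const)).add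
      (Real.continuous_mul_log.comp (continuous_sub_right 1)).continuousOn).sub
        Real.continuous_mul_log.continuousOn

/-- Near `l = 1` the term `(l - 1) * log (l - 1)` dominates. -/
theorem exists_logDeltaBound_neg {a Dinf : ℝ} (ha : 0 < a) (hDinf : 0 < Dinf) (D2 ε : ℝ) :
    ∃ l ∈ Ioo 1 (a / Dinf + 1), logDeltaBound a D2 Dinf ε l < 0 := by
  have hb : 1 < a / Dinf + 1 := by linarith [div_pos ha hDinf]
  have hlim : Tendsto (fun l => Real.log (l - 1) + (renyiBound a D2 Dinf l - ε)) (𝓝[>] 1)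
      atBot := by
    have h1 : Tendsto (fun l : ℝ => l - 1) (𝓝[>] 1) (𝓝[>] 0) := by
      refine tendsto_nhdsWithin_iff.2 ⟨?_, ?_⟩
      · have : Tendsto (fun l : ℝ => l - 1) (𝓝 1) (𝓝 (1 - 1)) := (continuous_sub_right 1).tendsto 1
        rw [sub_self] at this
        exact this.mono_left nhdsWithin_le_nhds
      · filter_upwards [self_mem_nhdsWithin] with l hl
        exact mem_Ioi.2 (sub_pos.2 (mem_Ioi.1 hl))
    have h2 : Tendsto (renyiBound a D2 Dinf) (𝓝[>] 1) (𝓝 (renyiBound a D2 Dinf 1)) :=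
      ((continuousOn_renyiBound hDinf D2).continuousAt (Iio_mem_nhds hb)).tendsto.mono_left
        nhdsWithin_le_nhds
    exact (Real.tendsto_log_nhdsGT_zero.comp h1).atBot_add (h2.sub_const ε)
  obtain ⟨l, hneg, hl⟩ := ((hlim.eventually_lt_atBot 0).and (Ioo_mem_nhdsGT hb)).exists
  refine ⟨l, hl, ?_⟩
  have h1 : 0 < l - 1 := by linarith [hl.1]
  have h2 := mul_neg_of_pos_of_neg h1 hneg
  have h3 : 0 ≤ l * Real.log l := mul_nonneg (by linarith) (Real.log_nonneg hl.1.le)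
  rw [logDeltaBound]
  linarith

/-- At the right endpoint the argument of `trigamma` tends to `0`, where `trigamma` blows up. -/
theorem tendsto_logDeltaBound {a D2 Dinf : ℝ} (ha : 0 < a) (hD2 : 0 < D2) (hDinf : 0 < Dinf)
    (ε : ℝ) :
    Tendsto (logDeltaBound a D2 Dinf ε) (𝓝[<] (a / Dinf + 1)) atTop := by
  set b := a / Dinf + 1 with hb
  have hb1 : 0 < b - 1 := by rw [hb, add_sub_cancel_right]; positivity
  have harg : Tendsto (fun l => a - (l - 1) * Dinf) (𝓝[<] b) (𝓝[>] 0) := by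
    refine tendsto_nhdsWithin_iff.2 ⟨?_, ?_⟩
    · have h : Continuous fun l => a - (l - 1) * Dinf := by fun_prop
      have h2 := h.tendsto b
      rw [hb, add_sub_cancel_right, div_mul_cancel₀ _ hDinf.ne', sub_self, ← hb] at h2
      exact h2.mono_left nhdsWithin_le_nhds
    · filter_upwards [self_mem_nhdsWithin] with l hl
      have : l - 1 < a / Dinf := by linarith [mem_Iio.1 hl]
      exact sub_pos.2 ((lt_div_iff₀ hDinf).1 this)
  have htri : Tendsto (fun l => trigamma (a - (l - 1) * Dinf)) (𝓝[<] b) atTop := by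
    have h0 : Tendsto trigamma (𝓝[>] 0) atTop := by
      have hinv := (tendsto_pow_atTop (two_ne_zero)).comp (tendsto_inv_nhdsGT_zero (𝕜 := ℝ))
      refine tendsto_atTop_mono' _ ?_ hinv
      filter_upwards [self_mem_nhdsWithin] with x hx
      simpa using one_div_sq_le_trigamma hx
    exact h0.comp harg
  have hid : Tendsto (fun l : ℝ => l) (𝓝[<] b) (𝓝 b) := nhdsWithin_le_nhds
  have hcoef : Tendsto (fun l : ℝ => 1 / 2 * l * D2 ^ 2) (𝓝[<] b) (𝓝 (1 / 2 * b * D2 ^ 2)) :=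
    (hid.const_mul _).mul_const _
  have hcoef0 : 0 < 1 / 2 * b * D2 ^ 2 := by
    have : 0 < b := by linarith
    positivity
  have hren : Tendsto (fun l => renyiBound a D2 Dinf l - ε) (𝓝[<] b) atTop :=
    tendsto_atTop_add_const_right _ (-ε) (hcoef.pos_mul_atTop hcoef0 htri)
  have hlog : Tendsto (fun l : ℝ => (l - 1) * Real.log (l - 1)) (𝓝[<] b)
      (𝓝 ((b - 1) * Real.log (b - 1))) :=
    ((Real.continuous_mul_log.comp (continuous_sub_right 1)).tendsto b).mono_left nhdsWithin_le_nhds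
  have hlog' : Tendsto (fun l : ℝ => l * Real.log l) (𝓝[<] b) (𝓝 (b * Real.log b)) :=
    (Real.continuous_mul_log.tendsto b).mono_left nhdsWithin_le_nhds
  have h := (((hid.sub_const 1).pos_mul_atTop hb1 hren).atTop_add hlog).atTop_add hlog'.neg
  exact h.congr fun l => (sub_eq_add_neg _ _).symm

theorem exists_isMinOn_deltaBound {a D2 Dinf : ℝ} (ha : 0 < a) (hD2 : 0 < D2) (hDinf : 0 < Dinf)
    (ε : ℝ) :
    ∃ l ∈ Ioo 1 (a / Dinf + 1), IsMinOn (deltaBound a D2 Dinf ε) (Ioo 1 (a / Dinf + 1)) l := by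
  obtain ⟨m, hm, hneg⟩ := exists_logDeltaBound_neg ha hDinf D2 ε
  have hev := (tendsto_logDeltaBound ha hD2 hDinf ε).eventually_ge_atTop 0
  obtain ⟨c, hcb, hc⟩ := (mem_nhdsLT_iff_exists_Ioo_subset' (a := a / Dinf + 1) hm.2).1 hev
  have hcb : c < a / Dinf + 1 := hcb
  have hmc : m ≤ c := by
    by_contra! h
    exact absurd (hc ⟨h, hm.2⟩) (not_le.2 hneg)
  obtain ⟨l, hl, hmin⟩ := isCompact_Icc.exists_isMinOn ⟨m, hm.1.le, hmc⟩
    ((continuousOn_logDeltaBound hDinf D2 ε).mono fun l (hl : l ∈ Icc 1 c) => hl.2.trans_lt hcb)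
  -- The function vanishes at `1` and is nonnegative beyond `c`, so a negative minimum over `[1, c]`
  -- is attained in the open interval and is global.
  have hlm := hmin (show m ∈ Icc 1 c from ⟨hm.1.le, hmc⟩)
  have hlneg : logDeltaBound a D2 Dinf ε l < 0 := lt_of_le_of_lt hlm hneg
  have hl1 : 1 < l := by
    refine lt_of_le_of_ne hl.1 fun h => ?_
    rw [← h] at hlneg
    simp [logDeltaBound] at hlneg
  refine ⟨l, ⟨hl1, hl.2.trans_lt hcb⟩, fun t ht => ?_⟩
  rw [mem_ofPred_eq, deltaBound_eq_exp hl1, deltaBound_eq_exp ht.1, Real.exp_le_exp]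
  rcases le_or_gt t c with htc | htc
  · exact hmin ⟨ht.1.le, htc⟩
  · exact hlneg.le.trans (hc ⟨htc, ht.2⟩)

end DirichletPrivacy

theorem theorem2 {N n : ℕ} (hn : 1 ≤ n) {X : Fin N → Type*}
    (x : (∀ i, X i) → Fin (n + 1) → ℝ) (α : Fin (n + 1) → ℝ) (Δ₂ Δinf ε : ℝ)
    (hα : ∀ i, 0 < α i) (hΔ₂ : 0 < Δ₂) (hΔinf : 0 < Δinf) (hε : 0 < ε)
    (hx : ∀ D i, 0 ≤ x D i)
    (hsens₂ : ∀ D D', DirichletPrivacy.Neighboring D D' →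
      ∑ i, (x D i - x D' i) ^ 2 ≤ Δ₂ ^ 2)
    (hsensinf : ∀ D D', DirichletPrivacy.Neighboring D D' →
      ∀ i, |x D i - x D' i| ≤ Δinf) :
    ∃ δ : ℝ,
      IsLeast (DirichletPrivacy.deltaBound (⨅ i, α i) Δ₂ Δinf ε ''
        Set.Ioo 1 ((⨅ i, α i) / Δinf + 1)) δ ∧
      DirichletPrivacy.IsDifferentiallyPrivate
        (fun D => DirichletPrivacy.dirichlet (x D + α)) ε δ := by
  have hinf : 0 < ⨅ i, α i := by
    obtain ⟨i, hi⟩ := exists_eq_ciInf_of_finite (f := α)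
    exact hi ▸ hα i
  have hle : ∀ D i, ⨅ i, α i ≤ (x D + α) i := fun D i =>
    (ciInf_le (finite_range α).bddBelow i).trans (le_add_of_nonneg_left (hx D i))
  obtain ⟨l, hl, hmin⟩ :=
    DirichletPrivacy.exists_isMinOn_deltaBound hinf hΔ₂ hΔinf ε
  refine ⟨_, ⟨Set.mem_image_of_mem _ hl, ?_⟩, ⟨fun D => ?_, fun D D' hDD' S hS => ?_⟩⟩
  · rintro _ ⟨t, ht, rfl⟩
    exact hmin ht
  · exact DirichletPrivacy.dirichlet_isProbabilityMeasure fun i =>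
      add_pos_of_nonneg_of_pos (hx D i) (hα i)
  · refine DirichletPrivacy.dirichlet_real_le hΔinf hl.1 ?_ (hle D) (hle D') ?_ ?_ ε hS
    · exact (lt_div_iff₀ hΔinf).1 (by linarith [hl.2])
    · simpa using hsens₂ D D' hDD'
    · simpa using hsensinf D D' hDD'
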